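/- **Theorem (convergence of the noncommutative Sinkhorn algorithm).** Let $N\ge 1$, let $\mathfrak h_1,\dots,\mathfrak h_N$ be finite-dimensional complex Hilbert spaces, $\mathfrak h_i=\mathbb C^{d_i}$, and let $\mathfrak h=\mathfrak h_1\otimes\dots\otimes\mathfrak h_N$. Write $\mathcal S(\mathfrak g)$ for the Hermitian operators on $\mathfrak g$ and $\mathfrak P(\mathfrak g)$ for the density matrices on $\mathfrak g$ (positive semidefinite operators of trace one). Let $H\in\mathcal S(\mathfrak h)$, let $\varepsilon>0$, and let $\gamma_i\in\mathfrak P(\mathfrak h_i)$ with $\ker\gamma_i=\{0\}$ for $i=1,\dots,N$; put $\boldsymbol\gamma=(\gamma_1,\dots,\gamma_N)$. For $U=(U_1,\dots,U_N)$ with $U_i\in\mathcal S(\mathfrak h_i)$ let $$\bigoplus_{i} U_i=\sum_{i=1}^N 1\otimes\dots\otimes U_i\otimes\dots\otimes 1,\qquad \Gamma_U=\exp\Big(\frac{\bigoplus_i U_i-H}{\varepsilon}\Big).$$ *Dual problem:* maximise $D(U)=\sum_{i=1}^N\operatorname{Tr}(U_i\gamma_i)-\varepsilon\operatorname{Tr}(\Gamma_U)+\varepsilon$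 over all $U\in\prod_{i=1}^N\mathcal S(\mathfrak h_i)$. *Primal problem:* minimise $\operatorname{Tr}(H\Gamma)+\varepsilon\operatorname{Tr}(\Gamma\log\Gamma)$ over all $\Gamma\in\mathfrak P(\mathfrak h)$ with marginals $\boldsymbol\gamma$, that is, such that $\operatorname{Tr}(\gamma_iA)=\operatorname{Tr}\big(\Gamma\,(1\otimes\dots\otimes A\otimes\dots\otimes1)\big)$, with $A$ in the $i$-th position, for all $i$ and all operators $A$ on $\mathfrak h_i$. For every $j\in\{1,\dots,N\}$ and every $U\in\prod_i\mathcal S(\mathfrak h_i)$ there is a unique $V\in\mathcal S(\mathfrak h_j)$ that maximises $V\mapsto D(U_1,\dots,U_{j-1},V,U_{j+1},\dots,U_N)$; it is called the $j$-th $(H,\varepsilon)$-transform $\mathfrak T_j(U)$ of $U$. Let $\mathcal T_j(U)=(U_1,\dots,U_{j-1},\mathfrak T_j(U),U_{j+1},\dots,U_N)$ and let $\tau=\mathcal T_N\circ\dots\circ\mathcal T_1$ be the Sinkhorn operator. Let $U^{(0)}\in\prod_i\mathcal S(\mathfrak h_i)$ be arbitrary, and let $U^{(n)}=\tau(U^{(n-1)})$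 for $n\ge1$ and $\Gamma^{(n)}=\Gamma_{U^{(n)}}$ for $n\ge0$. Then $\Gamma^{(n)}\in\mathfrak P(\mathfrak h)$ for all $n\ge1$, and: 1. There exist $U^\varepsilon\in\prod_i\mathcal S(\mathfrak h_i)$ and $\alpha^n\in\mathbb R^N$ with $\sum_{i=1}^N\alpha^n_i=0$ for every $n$ such that $\big(U^{(n)}_i+\alpha^n_i 1\big)_{i=1}^N\to U^\varepsilon$ as $n\to\infty$. 2. $U^\varepsilon$ is a maximiser of the dual problem. 3. $\Gamma^{(n)}$ converges as $n\to\infty$ to some $\Gamma^\varepsilon\in\mathfrak P(\mathfrak h)$ that has marginals $\boldsymbol\gamma$ and is a minimiser of the primal problem, and $\Gamma^\varepsilon=\exp\big((\bigoplus_i U_i^\varepsilon-H)/\varepsilon\big)$. -/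

import Mathlib

namespace QuantumSinkhorn

open scoped ComplexOrder

/-- The space `𝓢(ℂᵏ)` of Hermitian operators on `ℂᵏ`, as a real topological vector space. -/
abbrev Herm (k : ℕ) : Type := selfAdjoint (Matrix (Fin k) (Fin k) ℂ)

/-- Index set of the product basis `e_{x 1} ⊗ ⋯ ⊗ e_{x N}` of `ℂ^{d 1} ⊗ ⋯ ⊗ ℂ^{d N}`. -/
abbrev Idx {N : ℕ} (d : Fin N → ℕ) : Type := (i : Fin N) → Fin (d i)

/-- Operators on the composite system `ℂ^{d 1} ⊗ ⋯ ⊗ ℂ^{d N}`. -/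
abbrev Op {N : ℕ} (d : Fin N → ℕ) : Type := Matrix (Idx d) (Idx d) ℂ

/-- The tuples `U = (U_1, …, U_N)` of Hermitian operators, one on each factor. -/
abbrev Potentials {N : ℕ} (d : Fin N → ℕ) : Type := (i : Fin N) → Herm (d i)

/-- Density matrices: positive semidefinite with trace one. -/
def IsDensity {n : Type*} [Fintype n] (Γ : Matrix n n ℂ) : Prop :=
  Γ.PosSemidef ∧ Γ.trace = 1

section

variable {N : ℕ} {d : Fin N → ℕ}

/-- The operator `A_1 ⊗ ⋯ ⊗ A_N`, written in the product basis. -/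
def tensor (A : (i : Fin N) → Matrix (Fin (d i)) (Fin (d i)) ℂ) : Op d :=
  Matrix.of fun x y => ∏ i, A i (x i) (y i)

/-- The operator `1 ⊗ ⋯ ⊗ 1 ⊗ A ⊗ 1 ⊗ ⋯ ⊗ 1`, with `A` in the `i`-th position. -/
def embed (i : Fin N) (A : Matrix (Fin (d i)) (Fin (d i)) ℂ) : Op d :=
  tensor (Function.update (fun _ => 1) i A)

/-- The Kronecker sum `⨁ᵢ U_i = ∑ᵢ 1 ⊗ ⋯ ⊗ U_i ⊗ ⋯ ⊗ 1`. -/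
def oplus (U : Potentials d) : Op d := ∑ i, embed i (U i).1

/-- `Γ` has marginals `γ = (γ_1, …, γ_N)`:
`Tr (γ_i A) = Tr (Γ (1 ⊗ ⋯ ⊗ A ⊗ ⋯ ⊗ 1))` for all `i` and all operators `A` on `ℂ^{d i}`. -/
def HasMarginals (Γ : Op d) (γ : (i : Fin N) → Matrix (Fin (d i)) (Fin (d i)) ℂ) : Prop :=
  ∀ (i : Fin N) (A : Matrix (Fin (d i)) (Fin (d i)) ℂ),
    (γ i * A).trace = (Γ * embed i A).trace

/-- The operator `exp ((⨁ᵢ U_i - H) / ε)`. -/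
noncomputable def gibbs (H : Op d) (ε : ℝ) (U : Potentials d) : Op d :=
  NormedSpace.exp (ε⁻¹ • (oplus U - H))

/-- The entropy `S(Γ) = Tr (Γ log Γ)`, with the logarithm given by the functional calculus;
`Real.log 0 = 0` implements the convention `0 log 0 = 0`. -/
noncomputable def entropy (Γ : Op d) : ℝ := (Γ * cfc Real.log Γ).trace.re

/-- The primal functional `Tr (H Γ) + ε S(Γ)`. -/
noncomputable def primal (H : Op d) (ε : ℝ) (Γ : Op d) : ℝ :=
  (H * Γ).trace.re + ε * entropy Γ

/-- The dual functional `D(U) = ∑ᵢ Tr (U_i γ_i) - ε Tr exp ((⨁ᵢ U_i - H) / ε) + ε`. -/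
noncomputable def dual (H : Op d) (ε : ℝ)
    (γ : (i : Fin N) → Matrix (Fin (d i)) (Fin (d i)) ℂ) (U : Potentials d) : ℝ :=
  ∑ i, ((U i).1 * γ i).trace.re - ε * (gibbs H ε U).trace.re + ε

/-- The admissible set of the primal problem: density matrices with marginals `γ`. -/
def admissible (γ : (i : Fin N) → Matrix (Fin (d i)) (Fin (d i)) ℂ) : Set (Op d) :=
  {Γ | IsDensity Γ ∧ HasMarginals Γ γ}

/-- `Γ` is a minimiser of the primal problem. -/
def IsPrimalOptimal (H : Op d) (ε : ℝ)
    (γ : (i : Fin N) → Matrix (Fin (d i)) (Fin (d i)) ℂ) (Γ : Op d) : Prop :=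
  Γ ∈ admissible γ ∧ IsMinOn (primal H ε) (admissible γ) Γ

/-- `U` is a maximiser of the dual problem. -/
def IsDualOptimal (H : Op d) (ε : ℝ)
    (γ : (i : Fin N) → Matrix (Fin (d i)) (Fin (d i)) ℂ) (U : Potentials d) : Prop :=
  IsMaxOn (dual H ε γ) Set.univ U

/-- `V` maximises `D(U_1, …, U_{j-1}, V, U_{j+1}, …, U_N)` over the Hermitian operators on
`ℂ^{d j}`. -/
def IsTransform (H : Op d) (ε : ℝ)
    (γ : (i : Fin N) → Matrix (Fin (d i)) (Fin (d i)) ℂ) (j : Fin N) (U : Potentials d)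
    (V : Herm (d j)) : Prop :=
  IsMaxOn (fun W : Herm (d j) => dual H ε γ (Function.update U j W)) Set.univ V

/-- The `j`-th `(H, ε)`-transform of `U`: the maximiser of
`V ↦ D(U_1, …, U_{j-1}, V, U_{j+1}, …, U_N)`.  (That there is exactly one is part of the main
statement.) -/
noncomputable def transform (H : Op d) (ε : ℝ)
    (γ : (i : Fin N) → Matrix (Fin (d i)) (Fin (d i)) ℂ) (j : Fin N) (U : Potentials d) :
    Herm (d j) :=
  Classical.epsilon (IsTransform H ε γ j U)

/-- One step of the algorithm: replace the `j`-th component of `U` by the `j`-th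
`(H, ε)`-transform of `U`. -/
noncomputable def step (H : Op d) (ε : ℝ)
    (γ : (i : Fin N) → Matrix (Fin (d i)) (Fin (d i)) ℂ) (j : Fin N) (U : Potentials d) :
    Potentials d :=
  Function.update U j (transform H ε γ j U)

/-- The Sinkhorn operator `τ = step N ∘ ⋯ ∘ step 1` (the first component is updated first). -/
noncomputable def sinkhorn (H : Op d) (ε : ℝ)
    (γ : (i : Fin N) → Matrix (Fin (d i)) (Fin (d i)) ℂ) (U : Potentials d) : Potentials d :=
  (List.finRange N).foldl (fun W j => step H ε γ j W) U

/-- The iterates `U^(n) = τⁿ (U^(0))`. -/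
noncomputable def iterate (H : Op d) (ε : ℝ)
    (γ : (i : Fin N) → Matrix (Fin (d i)) (Fin (d i)) ℂ) (U₀ : Potentials d) (n : ℕ) :
    Potentials d :=
  (sinkhorn H ε γ)^[n] U₀

/-- The shifted tuple `U + a = (U_1 + a_1 1, …, U_N + a_N 1)`. -/
noncomputable def shift (U : Potentials d) (a : Fin N → ℝ) : Potentials d :=
  fun i => U i + a i • (1 : Herm (d i))

end

end QuantumSinkhorn

namespace QuantumSinkhorn

open scoped ComplexOrder

section Spectral

open Matrix

variable {n : Type*} [Fintype n] [DecidableEq n]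

/-- The squared moduli of the inner products of the eigenvectors of two Hermitian matrices. -/
noncomputable def overlap {A B : Matrix n n ℂ} (hA : A.IsHermitian) (hB : B.IsHermitian)
    (i j : n) : ℝ :=
  ‖(star (hA.eigenvectorUnitary : Matrix n n ℂ) * hB.eigenvectorUnitary) i j‖ ^ 2

theorem overlap_nonneg {A B : Matrix n n ℂ} (hA : A.IsHermitian) (hB : B.IsHermitian) (i j : n) :
    0 ≤ overlap hA hB i j :=
  sq_nonneg _

theorem trace_cfc_mul_cfc {A B : Matrix n n ℂ} (hA : A.IsHermitian) (hB : B.IsHermitian)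
    (f g : ℝ → ℝ) :
    (cfc f A * cfc g B).trace.re =
      ∑ i, ∑ j, f (hA.eigenvalues i) * g (hB.eigenvalues j) * overlap hA hB i j := by
  have key : (cfc f A * cfc g B).trace =
      ∑ i, ∑ j, (f (hA.eigenvalues i) * g (hB.eigenvalues j) * overlap hA hB i j : ℂ) := by
    rw [hA.cfc_eq, hB.cfc_eq, IsHermitian.cfc, IsHermitian.cfc, Unitary.conjStarAlgAut_apply,
      Unitary.conjStarAlgAut_apply]
    set U : Matrix n n ℂ := (hA.eigenvectorUnitary : Matrix n n ℂ) with hU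
    set V : Matrix n n ℂ := (hB.eigenvectorUnitary : Matrix n n ℂ) with hV
    have h1 : ∀ D E : Matrix n n ℂ, (U * D * star U * (V * E * star V)).trace =
        (D * (star U * V) * (E * star (star U * V))).trace := by
      intro D E
      rw [star_mul, star_star, mul_assoc U, mul_assoc U, trace_mul_comm U]
      simp only [mul_assoc]
    have h2 := h1 (diagonal (RCLike.ofReal ∘ f ∘ hA.eigenvalues))
      (diagonal (RCLike.ofReal ∘ g ∘ hB.eigenvalues))
    refine h2.trans ?_
    simp only [trace, diag_apply]
    refine Finset.sum_congr rfl fun i _ => ?_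
    rw [mul_apply]
    refine Finset.sum_congr rfl fun j _ => ?_
    rw [diagonal_mul, diagonal_mul, star_apply, overlap, ← hU, ← hV]
    have : ((‖(star U * V) i j‖ ^ 2 : ℝ) : ℂ) = (star U * V) i j * star ((star U * V) i j) := by
      rw [Complex.star_def, Complex.mul_conj']; simp
    rw [this]
    simp only [Function.comp_apply, Complex.coe_algebraMap]
    ring
  rw [key]
  simp only [← Complex.ofReal_mul, ← Complex.ofReal_sum, Complex.ofReal_re]

theorem eq_of_overlap {A B : Matrix n n ℂ} (hA : A.IsHermitian) (hB : B.IsHermitian)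
    (h : ∀ i j, overlap hA hB i j ≠ 0 → hA.eigenvalues i = hB.eigenvalues j) : A = B := by
  set U : Matrix n n ℂ := (hA.eigenvectorUnitary : Matrix n n ℂ) with hU
  set V : Matrix n n ℂ := (hB.eigenvectorUnitary : Matrix n n ℂ) with hV
  set D : Matrix n n ℂ := diagonal (RCLike.ofReal ∘ hA.eigenvalues) with hD
  set E : Matrix n n ℂ := diagonal (RCLike.ofReal ∘ hB.eigenvalues) with hE
  have hA' : A = U * D * star U := by
    conv_lhs => rw [hA.spectral_theorem, Unitary.conjStarAlgAut_apply]
  have hB' : B = V * E * star V := by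
    conv_lhs => rw [hB.spectral_theorem, Unitary.conjStarAlgAut_apply]
  have hUU : U * star U = 1 := by simp [hU]
  have hVV : V * star V = 1 := by simp [hV]
  have key : D * (star U * V) = (star U * V) * E := by
    ext i j
    rw [hD, hE, diagonal_mul, mul_diagonal]
    by_cases h0 : (star U * V) i j = 0
    · simp [h0]
    · have := h i j (by simpa [overlap, ← hU, ← hV] using h0)
      simp [this, mul_comm]
  calc A = U * (D * (star U * V)) * star V := by
        rw [hA']; simp only [mul_assoc]; rw [hVV, mul_one]
    _ = (U * star U) * (V * E * star V) := by rw [key]; simp only [mul_assoc]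
    _ = B := by rw [hUU, one_mul, hB']

theorem cfc_exp_eq {A : Matrix n n ℂ} (hA : A.IsHermitian) :
    cfc Real.exp A = NormedSpace.exp A := by
  rw [hA.cfc_eq, IsHermitian.cfc, Unitary.conjStarAlgAut_apply]
  conv_rhs => rw [hA.spectral_theorem, Unitary.conjStarAlgAut_apply]
  have hUU : (hA.eigenvectorUnitary : Matrix n n ℂ) * star (hA.eigenvectorUnitary : Matrix n n ℂ)
    = 1 := by simp
  have hinv : star (hA.eigenvectorUnitary : Matrix n n ℂ) =
      (hA.eigenvectorUnitary : Matrix n n ℂ)⁻¹ :=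
    (inv_eq_right_inv hUU).symm
  rw [hinv, exp_conj _ _ (IsUnit.of_mul_eq_one _ hUU), exp_diagonal]
  congr 3
  ext i
  simp [Pi.coe_exp, ← Complex.exp_eq_exp_ℂ]

theorem cfc_log_exp {A : Matrix n n ℂ} (hA : A.IsHermitian) :
    cfc Real.log (NormedSpace.exp A) = A := by
  rw [← cfc_exp_eq hA, ← cfc_comp Real.log Real.exp A hA.isSelfAdjoint
    ((A.finite_real_spectrum.image _).continuousOn _)
    (A.finite_real_spectrum.continuousOn _)]
  have : Real.log ∘ Real.exp = id := by ext; simp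
  rw [this, cfc_id ℝ A hA.isSelfAdjoint]

theorem posSemidef_exp {A : Matrix n n ℂ} (hA : A.IsHermitian) :
    (NormedSpace.exp A).PosSemidef := by
  rw [← cfc_exp_eq hA, hA.cfc_eq, IsHermitian.cfc, Unitary.conjStarAlgAut_apply]
  refine PosSemidef.mul_mul_conjTranspose_same (PosSemidef.diagonal fun i => ?_) _
  exact Complex.zero_le_real.2 (Real.exp_pos _).le

theorem continuous_exp : Continuous (NormedSpace.exp : Matrix n n ℂ → Matrix n n ℂ) := by
  let _ : NormedRing (Matrix n n ℂ) := Matrix.linftyOpNormedRing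
  let _ : NormedAlgebra ℂ (Matrix n n ℂ) := Matrix.linftyOpNormedAlgebra
  let _ : NormedAlgebra ℚ (Matrix n n ℂ) := Matrix.linftyOpNormedAlgebra
  have : CompleteSpace (Matrix n n ℂ) := FiniteDimensional.complete ℂ _
  exact NormedSpace.exp_continuous

/-- The Bregman divergence of `A ↦ Tr exp A`. -/
noncomputable def breg (A B : Matrix n n ℂ) : ℝ :=
  (NormedSpace.exp B).trace.re - (NormedSpace.exp A).trace.re
    - (NormedSpace.exp A * (B - A)).trace.re

theorem continuous_breg :
    Continuous fun p : Matrix n n ℂ × Matrix n n ℂ => breg p.1 p.2 := by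
  have h := continuous_exp (n := n)
  unfold breg
  fun_prop

theorem breg_eq_sum {A B : Matrix n n ℂ} (hA : A.IsHermitian) (hB : B.IsHermitian) :
    breg A B = ∑ i, ∑ j, (Real.exp (hB.eigenvalues j) - Real.exp (hA.eigenvalues i) -
      Real.exp (hA.eigenvalues i) * (hB.eigenvalues j - hA.eigenvalues i)) *
        overlap hA hB i j := by
  have e1 := trace_cfc_mul_cfc hA hB (fun _ => 1) Real.exp
  have e2 := trace_cfc_mul_cfc hA hB Real.exp (fun _ => 1)
  have e3 := trace_cfc_mul_cfc hA hB Real.exp id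
  have e4 := trace_cfc_mul_cfc hA hB (fun x => Real.exp x * x) (fun _ => 1)
  have o (M : Matrix n n ℂ) (hM : M.IsHermitian) : cfc (fun _ : ℝ => (1 : ℝ)) M = 1 :=
    cfc_const_one ℝ M hM.isSelfAdjoint
  have e5 : cfc (fun x => Real.exp x * x) A = NormedSpace.exp A * A := by
    rw [cfc_mul Real.exp (fun x => x) A (A.finite_real_spectrum.continuousOn _)
      (A.finite_real_spectrum.continuousOn _), cfc_exp_eq hA, cfc_id' ℝ A hA.isSelfAdjoint]
  rw [o A hA, cfc_exp_eq hB, one_mul] at e1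
  rw [o B hB, cfc_exp_eq hA, mul_one] at e2
  rw [cfc_exp_eq hA, cfc_id ℝ B hB.isSelfAdjoint] at e3
  rw [o B hB, e5, mul_one] at e4
  rw [breg, mul_sub, trace_sub, Complex.sub_re, e1, e2, e3, e4]
  simp only [← Finset.sum_sub_distrib]
  refine Finset.sum_congr rfl fun i _ => Finset.sum_congr rfl fun j _ => ?_
  simp only [id]
  ring

theorem exp_sub_exp_nonneg (a b : ℝ) : 0 ≤ Real.exp b - Real.exp a - Real.exp a * (b - a) := by
  have h := Real.add_one_le_exp (b - a)
  have : Real.exp b = Real.exp a * Real.exp (b - a) := by rw [← Real.exp_add]; ring_nf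
  rw [this]
  nlinarith [Real.exp_pos a]

theorem eq_of_exp_sub_exp_eq_zero {a b : ℝ}
    (h : Real.exp b - Real.exp a - Real.exp a * (b - a) = 0) : a = b := by
  by_contra hne
  have h' := Real.add_one_lt_exp (sub_ne_zero.2 (Ne.symm hne))
  have : Real.exp b = Real.exp a * Real.exp (b - a) := by rw [← Real.exp_add]; ring_nf
  rw [this] at h
  nlinarith [Real.exp_pos a]

theorem breg_nonneg {A B : Matrix n n ℂ} (hA : A.IsHermitian) (hB : B.IsHermitian) :
    0 ≤ breg A B := by
  rw [breg_eq_sum hA hB]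
  exact Finset.sum_nonneg fun i _ => Finset.sum_nonneg fun j _ =>
    mul_nonneg (exp_sub_exp_nonneg _ _) (overlap_nonneg _ _ _ _)

theorem eq_of_breg_eq_zero {A B : Matrix n n ℂ} (hA : A.IsHermitian) (hB : B.IsHermitian)
    (h : breg A B = 0) : A = B := by
  rw [breg_eq_sum hA hB] at h
  have nn (i j : n) := mul_nonneg (exp_sub_exp_nonneg (hA.eigenvalues i) (hB.eigenvalues j))
    (overlap_nonneg hA hB i j)
  rw [Finset.sum_eq_zero_iff_of_nonneg fun i _ => Finset.sum_nonneg fun j _ => nn i j] at h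
  refine eq_of_overlap hA hB fun i j hij => ?_
  have h1 := h i (Finset.mem_univ _)
  rw [Finset.sum_eq_zero_iff_of_nonneg fun j _ => nn i j] at h1
  exact eq_of_exp_sub_exp_eq_zero ((mul_eq_zero.1 (h1 j (Finset.mem_univ _))).resolve_right hij)

/-- The Gibbs variational principle. -/
theorem trace_mul_sub_trace_exp_le_entropy {Γ Y : Matrix n n ℂ} (hΓ : Γ.PosSemidef)
    (hY : Y.IsHermitian) :
    (Γ * Y).trace.re - (NormedSpace.exp Y).trace.re ≤
      (Γ * cfc Real.log Γ).trace.re - Γ.trace.re := by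
  have hA := hΓ.isHermitian
  have e1 := trace_cfc_mul_cfc hA hY (fun _ => 1) Real.exp
  have e2 := trace_cfc_mul_cfc hA hY id (fun _ => 1)
  have e3 := trace_cfc_mul_cfc hA hY id id
  have e4 := trace_cfc_mul_cfc hA hY (fun x => x * Real.log x) (fun _ => 1)
  have o (M : Matrix n n ℂ) (hM : M.IsHermitian) : cfc (fun _ : ℝ => (1 : ℝ)) M = 1 :=
    cfc_const_one ℝ M hM.isSelfAdjoint
  have e5 : cfc (fun x => x * Real.log x) Γ = Γ * cfc Real.log Γ := by
    rw [cfc_mul (fun x => x) Real.log Γ (Γ.finite_real_spectrum.continuousOn _)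
      (Γ.finite_real_spectrum.continuousOn _), cfc_id' ℝ Γ hA.isSelfAdjoint]
  rw [o Γ hA, cfc_exp_eq hY, one_mul] at e1
  rw [o Y hY, cfc_id ℝ Γ hA.isSelfAdjoint, mul_one] at e2
  rw [cfc_id ℝ Γ hA.isSelfAdjoint, cfc_id ℝ Y hY.isSelfAdjoint] at e3
  rw [o Y hY, e5, mul_one] at e4
  rw [e1, e2, e3, e4]
  simp only [← Finset.sum_sub_distrib]
  refine Finset.sum_le_sum fun i _ => Finset.sum_le_sum fun j _ => ?_
  have hp := hΓ.eigenvalues_nonneg i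
  have ho := overlap_nonneg hA hY i j
  set p := hA.eigenvalues i
  set y := hY.eigenvalues j
  simp only [id, mul_one, one_mul]
  rw [← sub_mul, ← sub_mul]
  refine mul_le_mul_of_nonneg_right ?_ ho
  rcases hp.eq_or_lt with h0 | h0
  · rw [← h0]; simp [(Real.exp_pos y).le]
  · have := exp_sub_exp_nonneg (Real.log p) y
    rw [Real.exp_log h0] at this
    linarith

end Spectral

section Coercivity

open Matrix

variable {n : Type*} [Fintype n] [DecidableEq n]

theorem trace_cfc {A : Matrix n n ℂ} (hA : A.IsHermitian) (f : ℝ → ℝ) :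
    (cfc f A).trace.re = ∑ i, f (hA.eigenvalues i) := by
  rw [hA.cfc_eq, IsHermitian.cfc, Unitary.conjStarAlgAut_apply, trace_mul_cycle,
    Unitary.coe_star_mul_self, one_mul, trace_diagonal]
  simp

theorem norm_apply_le_sum_abs_eigenvalues {A : Matrix n n ℂ} (hA : A.IsHermitian) (x y : n) :
    ‖A x y‖ ≤ ∑ i, |hA.eigenvalues i| := by
  conv_lhs => rw [hA.spectral_theorem, Unitary.conjStarAlgAut_apply, mul_apply]
  refine (norm_sum_le _ _).trans (Finset.sum_le_sum fun i _ => ?_)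
  rw [mul_diagonal, norm_mul, norm_mul, star_apply, norm_star]
  have h1 := entry_norm_bound_of_unitary hA.eigenvectorUnitary.2 x i
  have h2 := entry_norm_bound_of_unitary hA.eigenvectorUnitary.2 y i
  have h3 : ‖(RCLike.ofReal ∘ hA.eigenvalues : n → ℂ) i‖ = |hA.eigenvalues i| := by simp
  rw [h3]
  calc _ ≤ 1 * |hA.eigenvalues i| * 1 := by gcongr
    _ = _ := by ring

theorem mul_sub_exp_le {c p y : ℝ} (hcp : c ≤ p) (hp : p ≤ 1) :
    p * y - Real.exp y ≤ -c * |y| := by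
  rcases le_total 0 y with hy | hy
  · rw [abs_of_nonneg hy]
    have := Real.quadratic_le_exp_of_nonneg hy
    nlinarith [sq_nonneg (y - 1), mul_nonneg (sub_nonneg.2 hp) hy,
      mul_nonneg (sub_nonneg.2 (hcp.trans hp)) hy, sq_nonneg (y - 2)]
  · rw [abs_of_nonpos hy]
    nlinarith [Real.exp_pos y]

theorem exists_trace_mul_sub_trace_exp_le {G : Matrix n n ℂ} (hG : G.PosDef) (hG1 : G.trace = 1) :
    ∃ c > 0, ∀ Y : Matrix n n ℂ, ∀ hY : Y.IsHermitian,
      (G * Y).trace.re - (NormedSpace.exp Y).trace.re ≤ -c * ∑ i, |hY.eigenvalues i| := by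
  have hne : Nonempty n := by
    by_contra h
    rw [not_nonempty_iff] at h
    simp [trace] at hG1
  have hA := hG.isHermitian
  have hsum : ∑ i, hA.eigenvalues i = 1 := by
    have := hA.trace_eq_sum_eigenvalues
    rw [hG1] at this
    exact Complex.ofReal_injective (by rw [Complex.ofReal_sum]; exact this.symm)
  obtain ⟨i₀, -, hi₀⟩ := Finset.exists_min_image Finset.univ hA.eigenvalues Finset.univ_nonempty
  refine ⟨hA.eigenvalues i₀, hG.eigenvalues_pos i₀, fun Y hY => ?_⟩
  have hle (i : n) : hA.eigenvalues i ≤ 1 := by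
    rw [← hsum]
    exact Finset.single_le_sum (fun j _ => (hG.eigenvalues_pos j).le) (Finset.mem_univ i)
  have e1 := trace_cfc_mul_cfc hA hY (fun _ => 1) Real.exp
  have e3 := trace_cfc_mul_cfc hA hY id id
  have e4 := trace_cfc_mul_cfc hA hY (fun _ => 1) (fun y => |y|)
  have o : cfc (fun _ : ℝ => (1 : ℝ)) G = 1 := cfc_const_one ℝ G hA.isSelfAdjoint
  rw [o, cfc_exp_eq hY, one_mul] at e1
  rw [o, one_mul, trace_cfc hY] at e4
  rw [cfc_id ℝ G hA.isSelfAdjoint, cfc_id ℝ Y hY.isSelfAdjoint] at e3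
  rw [e1, e3, e4, Finset.mul_sum]
  simp only [← Finset.sum_sub_distrib, Finset.mul_sum]
  refine Finset.sum_le_sum fun i _ => Finset.sum_le_sum fun j _ => ?_
  simp only [id, one_mul]
  rw [← sub_mul, ← mul_assoc]
  exact mul_le_mul_of_nonneg_right
    (mul_sub_exp_le (hi₀ i (Finset.mem_univ _)) (hle i))
    (overlap_nonneg _ _ _ _)

theorem isCompact_superlevel {G : Matrix n n ℂ} (hG : G.PosDef) (hG1 : G.trace = 1) (r : ℝ) :
    IsCompact {Y : Matrix n n ℂ | Y.IsHermitian ∧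
      r ≤ (G * Y).trace.re - (NormedSpace.exp Y).trace.re} := by
  obtain ⟨c, hc, hbound⟩ := exists_trace_mul_sub_trace_exp_le hG hG1
  have hK : IsCompact (Set.univ.pi fun _ : n => Set.univ.pi fun _ : n =>
      Metric.closedBall (0 : ℂ) (-r / c)) :=
    isCompact_univ_pi fun _ => isCompact_univ_pi fun _ => isCompact_closedBall _ _
  refine IsCompact.of_isClosed_subset (s := (Set.univ.pi fun _ : n => Set.univ.pi fun _ : n =>
      Metric.closedBall (0 : ℂ) (-r / c) : Set (Matrix n n ℂ))) hK ?_ ?_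
  · have h := continuous_exp (n := n)
    have h1 : Continuous fun Y : Matrix n n ℂ => Yᴴ := by fun_prop
    have h2 : Continuous fun Y : Matrix n n ℂ =>
        (G * Y).trace.re - (NormedSpace.exp Y).trace.re := by fun_prop
    exact (isClosed_eq h1 continuous_id).inter (isClosed_le continuous_const h2)
  · rintro Y ⟨hY, hr⟩ x - y -
    rw [mem_closedBall_zero_iff, le_div_iff₀ hc]
    have := hbound Y hY
    have := norm_apply_le_sum_abs_eigenvalues hY x y
    nlinarith

end Coercivity

section Tensor

open Matrix

variable {N : ℕ} {d : Fin N → ℕ}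

theorem tensor_mul_tensor (A B : (i : Fin N) → Matrix (Fin (d i)) (Fin (d i)) ℂ) :
    tensor A * tensor B = tensor fun i => A i * B i := by
  ext x y
  simp only [tensor, mul_apply, of_apply, Fintype.prod_sum, Finset.prod_mul_distrib]

theorem trace_tensor (A : (i : Fin N) → Matrix (Fin (d i)) (Fin (d i)) ℂ) :
    (tensor A).trace = ∏ i, (A i).trace := by
  simp only [tensor, trace, diag_apply, of_apply, Fintype.prod_sum]

theorem tensor_one : tensor (fun i => (1 : Matrix (Fin (d i)) (Fin (d i)) ℂ)) = 1 := by
  ext x y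
  simp only [tensor, of_apply, one_apply]
  by_cases h : x = y
  · simp [h]
  · obtain ⟨i, hi⟩ := Function.ne_iff.1 h
    rw [if_neg h]
    exact Finset.prod_eq_zero (Finset.mem_univ i) (if_neg hi)

theorem conjTranspose_tensor (A : (i : Fin N) → Matrix (Fin (d i)) (Fin (d i)) ℂ) :
    (tensor A)ᴴ = tensor fun i => (A i)ᴴ := by
  ext x y
  simp [tensor, conjTranspose_apply]

open scoped MatrixOrder Matrix.Norms.L2Operator in
theorem exists_eq_conjTranspose_mul_self {k : ℕ} {A : Matrix (Fin k) (Fin k) ℂ}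
    (hA : A.PosSemidef) : ∃ B : Matrix (Fin k) (Fin k) ℂ, A = Bᴴ * B :=
  CStarAlgebra.nonneg_iff_eq_star_mul_self.mp hA.nonneg

theorem posDef_tensor {γ : (i : Fin N) → Matrix (Fin (d i)) (Fin (d i)) ℂ}
    (hγ : ∀ i, (γ i).PosSemidef) (hker : ∀ i, ∀ v : Fin (d i) → ℂ, (γ i).mulVec v = 0 → v = 0) :
    (tensor γ).PosDef := by
  have hex (i : Fin N) : ∃ B : Matrix (Fin (d i)) (Fin (d i)) ℂ, γ i = Bᴴ * B ∧ IsUnit B := by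
    obtain ⟨B, hB⟩ := exists_eq_conjTranspose_mul_self (hγ i)
    refine ⟨B, hB, ?_⟩
    rw [← mulVec_injective_iff_isUnit]
    refine (injective_iff_map_eq_zero B.mulVecLin).2 fun v hv => hker i v ?_
    rw [hB, ← mulVec_mulVec]
    have : B *ᵥ v = 0 := hv
    rw [this, mulVec_zero]
  choose B hB hu using hex
  have h1 : tensor γ = (tensor B)ᴴ * tensor B := by
    rw [conjTranspose_tensor, tensor_mul_tensor]
    exact congrArg tensor (funext hB)
  rw [h1]
  refine PosDef.conjTranspose_mul_self _ (mulVec_injective_iff_isUnit.2 ?_)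
  refine IsUnit.of_mul_eq_one (tensor fun i => (B i)⁻¹) ?_
  rw [tensor_mul_tensor, ← tensor_one]
  refine congrArg tensor (funext fun i => mul_nonsing_inv _ ((isUnit_iff_isUnit_det _).1 (hu i)))

theorem embed_apply (i : Fin N) (A : Matrix (Fin (d i)) (Fin (d i)) ℂ) (x y : Idx d) :
    embed i A x y = A (x i) (y i) * ∏ k ∈ Finset.univ.erase i,
      (1 : Matrix (Fin (d k)) (Fin (d k)) ℂ) (x k) (y k) := by
  rw [embed, tensor, of_apply, ← Finset.mul_prod_erase _ _ (Finset.mem_univ i),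
    Function.update_self]
  congr 1
  exact Finset.prod_congr rfl fun k hk => by
    rw [Function.update_of_ne (Finset.ne_of_mem_erase hk)]

/-- The map `embed i` as a complex linear map. -/
noncomputable def embedLin (i : Fin N) : Matrix (Fin (d i)) (Fin (d i)) ℂ →ₗ[ℂ] Op d where
  toFun := embed i
  map_add' A B := by ext x y; simp [embed_apply, add_mul]
  map_smul' c A := by ext x y; simp [embed_apply, mul_assoc]

theorem embed_one (i : Fin N) : embed (d := d) i 1 = 1 := by
  rw [embed, Function.update_eq_self_iff.2 rfl, tensor_one]

theorem conjTranspose_embed (i : Fin N) (A : Matrix (Fin (d i)) (Fin (d i)) ℂ) :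
    (embed (d := d) i A)ᴴ = embed i Aᴴ := by
  rw [embed, conjTranspose_tensor, embed]
  congr 1
  funext k
  rcases eq_or_ne k i with rfl | h
  · simp
  · simp [Function.update_of_ne h]

theorem isHermitian_embed (i : Fin N) (W : Herm (d i)) : (embed (d := d) i W.1).IsHermitian := by
  rw [IsHermitian, conjTranspose_embed]
  exact congrArg (embed i) W.2

theorem isHermitian_oplus (U : Potentials d) : (oplus U).IsHermitian := by
  rw [IsHermitian, oplus, conjTranspose_sum]
  exact Finset.sum_congr rfl fun i _ => isHermitian_embed i (U i)

theorem trace_tensor_mul_embed (B : (i : Fin N) → Matrix (Fin (d i)) (Fin (d i)) ℂ) (i : Fin N)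
    (A : Matrix (Fin (d i)) (Fin (d i)) ℂ) :
    (tensor B * embed i A).trace = (B i * A).trace * ∏ k ∈ Finset.univ.erase i, (B k).trace := by
  rw [embed, tensor_mul_tensor, trace_tensor, ← Finset.mul_prod_erase _ _ (Finset.mem_univ i),
    Function.update_self]
  congr 1
  exact Finset.prod_congr rfl fun k hk => by
    rw [Function.update_of_ne (Finset.ne_of_mem_erase hk), mul_one]

variable {γ : (i : Fin N) → Matrix (Fin (d i)) (Fin (d i)) ℂ}

theorem trace_tensor_mul_embed_of_trace_eq_one (hγ : ∀ i, (γ i).trace = 1) (i : Fin N)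
    (A : Matrix (Fin (d i)) (Fin (d i)) ℂ) :
    (tensor γ * embed i A).trace = (γ i * A).trace := by
  rw [trace_tensor_mul_embed, Finset.prod_eq_one fun k _ => hγ k, mul_one]

theorem trace_tensor_update_mul_embed_self (hγ : ∀ i, (γ i).trace = 1) (i : Fin N)
    (E A : Matrix (Fin (d i)) (Fin (d i)) ℂ) :
    (tensor (Function.update γ i E) * embed i A).trace = (E * A).trace := by
  rw [trace_tensor_mul_embed, Function.update_self, Finset.prod_eq_one, mul_one]
  intro k hk
  rw [Function.update_of_ne (Finset.ne_of_mem_erase hk), hγ]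

theorem trace_tensor_update_mul_embed_of_ne (hγ : ∀ i, (γ i).trace = 1) {i k : Fin N} (h : k ≠ i)
    (E : Matrix (Fin (d i)) (Fin (d i)) ℂ) (A : Matrix (Fin (d k)) (Fin (d k)) ℂ) :
    (tensor (Function.update γ i E) * embed k A).trace = (γ k * A).trace * E.trace := by
  rw [trace_tensor_mul_embed, Function.update_of_ne h, Finset.prod_eq_single i,
    Function.update_self]
  · intro l _ hl
    rw [Function.update_of_ne hl, hγ]
  · exact fun h' => absurd (Finset.mem_erase.2 ⟨h.symm, Finset.mem_univ _⟩) h'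

theorem embed_injective (hγ : ∀ i, (γ i).trace = 1) (i : Fin N) :
    Function.Injective (embed (d := d) i) := by
  intro A B h
  rw [ext_iff_trace_mul_left]
  intro E
  rw [← trace_tensor_update_mul_embed_self hγ i E A, h, trace_tensor_update_mul_embed_self hγ]

/-- The Kronecker sum as a real linear map. -/
noncomputable def oplusLin : Potentials d →ₗ[ℝ] Op d where
  toFun := oplus
  map_add' U V := by
    simp only [oplus, ← Finset.sum_add_distrib]
    exact Finset.sum_congr rfl fun i _ => (embedLin i).map_add _ _
  map_smul' c U := by
    simp only [oplus, Finset.smul_sum, RingHom.id_apply]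
    exact Finset.sum_congr rfl fun i _ => ((embedLin i).restrictScalars ℝ).map_smul c _

theorem oplusLin_apply (U : Potentials d) : oplusLin U = oplus U := rfl

theorem oplus_update (U : Potentials d) (j : Fin N) (V W : Herm (d j)) :
    oplus (Function.update U j W) = oplus (Function.update U j V) + embed j (W - V).1 := by
  have h1 (W : Herm (d j)) : oplus (Function.update U j W) =
      embed j W.1 + ∑ k ∈ Finset.univ.erase j, embed k (U k).1 := by
    rw [oplus, ← Finset.add_sum_erase _ _ (Finset.mem_univ j), Function.update_self]
    congr 1
    exact Finset.sum_congr rfl fun k hk => by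
      rw [Function.update_of_ne (Finset.ne_of_mem_erase hk)]
  rw [h1, h1]
  have : embed (d := d) j (W - V).1 = embed j W.1 - embed j V.1 := (embedLin j).map_sub _ _
  rw [this]
  abel

theorem exists_shift_of_oplus_eq (hγ : ∀ i, (γ i).trace = 1) {U V : Potentials d}
    (h : oplus V = oplus U) : ∃ a : Fin N → ℝ, ∑ i, a i = 0 ∧ V = shift U a := by
  set W : Potentials d := V - U with hW
  have hW0 : oplus W = 0 := by
    rw [← oplusLin_apply, hW, map_sub, oplusLin_apply, oplusLin_apply, h, sub_self]
  set s : Fin N → ℂ := fun i => -∑ k ∈ Finset.univ.erase i, (γ k * (W k).1).trace with hs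
  have hWs (i : Fin N) : (W i).1 = s i • (1 : Matrix (Fin (d i)) (Fin (d i)) ℂ) := by
    rw [ext_iff_trace_mul_left]
    intro E
    have h0 : (tensor (Function.update γ i E) * oplus W).trace = 0 := by rw [hW0]; simp
    rw [oplus, Finset.mul_sum, trace_sum, ← Finset.add_sum_erase _ _ (Finset.mem_univ i),
      trace_tensor_update_mul_embed_self hγ] at h0
    rw [Finset.sum_congr rfl fun k hk =>
      trace_tensor_update_mul_embed_of_ne hγ (Finset.ne_of_mem_erase hk) E (W k).1,
      ← Finset.sum_mul] at h0
    rw [Matrix.mul_smul, trace_smul, mul_one, hs, smul_eq_mul]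
    linear_combination h0
  have ht (i : Fin N) : (γ i * (W i).1).trace = s i := by
    rw [hWs, Matrix.mul_smul, mul_one, trace_smul, hγ, smul_eq_mul, mul_one]
  have hsum : ∑ i, s i = 0 := by
    rcases isEmpty_or_nonempty (Fin N) with hN | ⟨⟨i⟩⟩
    · simp
    · rw [← Finset.add_sum_erase _ _ (Finset.mem_univ i)]
      have : s i = -∑ k ∈ Finset.univ.erase i, s k :=
        congrArg Neg.neg (Finset.sum_congr rfl fun k _ => ht k)
      rw [this, neg_add_cancel]
  have hre (i : Fin N) : (W i).1 = (s i).re • (1 : Matrix (Fin (d i)) (Fin (d i)) ℂ) := by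
    have h1 : (W i).1 = star (s i) • (1 : Matrix (Fin (d i)) (Fin (d i)) ℂ) := by
      have : star (W i).1 = (W i).1 := (W i).2
      rw [← this, hWs i, star_smul, star_one]
    have h2 : (2 : ℂ) • (W i).1 = (2 : ℂ) • ((s i).re • (1 : Matrix (Fin (d i)) (Fin (d i)) ℂ)) := by
      have h3 : (2 : ℂ) • ((s i).re • (1 : Matrix (Fin (d i)) (Fin (d i)) ℂ)) =
          (s i + star (s i)) • (1 : Matrix (Fin (d i)) (Fin (d i)) ℂ) := by
        rw [Complex.star_def, Complex.add_conj, ← Complex.coe_smul, smul_smul]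
        push_cast
        rfl
      rw [h3, add_smul, ← hWs i, ← h1, two_smul]
    exact smul_right_injective _ two_ne_zero h2
  refine ⟨fun i => (s i).re, ?_, ?_⟩
  · rw [← Complex.re_sum, hsum, Complex.zero_re]
  · funext i
    have : V i = U i + W i := by simp [hW]
    rw [this, shift]
    congr 1
    exact Subtype.ext (hre i)

instance finiteDimensional_herm (k : ℕ) : FiniteDimensional ℝ (Herm k) :=
  inferInstanceAs (FiniteDimensional ℝ (selfAdjoint.submodule ℝ (Matrix (Fin k) (Fin k) ℂ)))

instance continuousSMul_herm (k : ℕ) : ContinuousSMul ℝ (Herm k) :=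
  inferInstanceAs (ContinuousSMul ℝ (selfAdjoint.submodule ℝ (Matrix (Fin k) (Fin k) ℂ)))

theorem continuous_oplus : Continuous (oplus : Potentials d → Op d) :=
  (oplusLin (d := d)).continuous_of_finiteDimensional

end Tensor

section Optimization

open Matrix Filter Topology

variable {N : ℕ} {d : Fin N → ℕ}

/-- The exponent `(X - H) / ε` of the Gibbs operator. -/
noncomputable def expo (H : Op d) (ε : ℝ) (X : Op d) : Op d := ε⁻¹ • (X - H)

/-- The dual functional as a function of `X = ⨁ᵢ U_i`. -/
noncomputable def dualFun (H : Op d) (ε : ℝ) (γ : (i : Fin N) → Matrix (Fin (d i)) (Fin (d i)) ℂ)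
    (X : Op d) : ℝ :=
  (tensor γ * X).trace.re - ε * (NormedSpace.exp (expo H ε X)).trace.re + ε

/-- The derivative of `dualFun` at `X` in the directions of the `j`-th block vanishes. -/
def Stationary (H : Op d) (ε : ℝ) (γ : (i : Fin N) → Matrix (Fin (d i)) (Fin (d i)) ℂ)
    (j : Fin N) (X : Op d) : Prop :=
  ∀ W : Herm (d j), ((tensor γ - NormedSpace.exp (expo H ε X)) * embed j W.1).trace.re = 0

variable {H : Op d} {ε : ℝ} {γ : (i : Fin N) → Matrix (Fin (d i)) (Fin (d i)) ℂ}

theorem continuous_expo : Continuous (expo H ε) := by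
  unfold expo; fun_prop

theorem continuous_exp_expo : Continuous fun X => NormedSpace.exp (expo H ε X) :=
  continuous_exp.comp continuous_expo

theorem continuous_dualFun : Continuous (dualFun H ε γ) := by
  have h := continuous_exp_expo (H := H) (ε := ε)
  unfold dualFun
  fun_prop

theorem isHermitian_expo (hH : H.IsHermitian) {X : Op d} (hX : X.IsHermitian) :
    (expo H ε X).IsHermitian := by
  have : (X - H)ᴴ = X - H := hX.sub hH
  rw [IsHermitian, expo, conjTranspose_smul, this, star_trivial]

theorem isClosed_stationary (j : Fin N) : IsClosed {X | Stationary H ε γ j X} := by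
  have h := continuous_exp_expo (H := H) (ε := ε)
  simp only [Stationary, Set.ofPred_forall]
  refine isClosed_iInter fun W => isClosed_eq ?_ continuous_const
  fun_prop

theorem dual_eq_dualFun (hγ : ∀ i, (γ i).trace = 1) (U : Potentials d) :
    dual H ε γ U = dualFun H ε γ (oplus U) := by
  rw [dual, dualFun, oplus, Finset.mul_sum, trace_sum, Complex.re_sum]
  congr 2
  exact Finset.sum_congr rfl fun i _ => by
    rw [trace_tensor_mul_embed_of_trace_eq_one hγ, trace_mul_comm]

theorem dualFun_eq (hε : 0 < ε) (X Y : Op d) :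
    dualFun H ε γ Y = dualFun H ε γ X +
      ((tensor γ - NormedSpace.exp (expo H ε X)) * (Y - X)).trace.re
      - ε * breg (expo H ε X) (expo H ε Y) := by
  have h1 : expo H ε Y - expo H ε X = ε⁻¹ • (Y - X) := by
    rw [expo, expo, ← smul_sub]; congr 1; abel
  have h2 : (NormedSpace.exp (expo H ε X) * (ε⁻¹ • (Y - X))).trace.re =
      ε⁻¹ * (NormedSpace.exp (expo H ε X) * (Y - X)).trace.re := by
    rw [Matrix.mul_smul, trace_smul, Complex.real_smul, Complex.re_ofReal_mul]
  rw [dualFun, dualFun, breg, h1, h2, sub_mul, trace_sub, Complex.sub_re, mul_sub (tensor γ),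
    trace_sub, Complex.sub_re]
  field_simp
  ring

theorem isCompact_dualFun_superlevel (hH : H.IsHermitian) (hε : 0 < ε) (hG : (tensor γ).PosDef)
    (hγ : ∀ i, (γ i).trace = 1) (r : ℝ) :
    IsCompact {X : Op d | X.IsHermitian ∧ r ≤ dualFun H ε γ X} := by
  have hG1 : (tensor γ).trace = 1 := by
    rw [trace_tensor, Finset.prod_eq_one fun i _ => hγ i]
  have hc := isCompact_superlevel hG hG1 (ε⁻¹ * (r - ε - (tensor γ * H).trace.re))
  have hm : Continuous fun Y : Op d => ε • Y + H := by fun_prop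
  refine (hc.image hm).of_isClosed_subset ?_ ?_
  · have h1 : Continuous fun Y : Op d => Yᴴ := by fun_prop
    exact (isClosed_eq h1 continuous_id).inter (isClosed_le continuous_const continuous_dualFun)
  · rintro X ⟨hX, hr⟩
    refine ⟨expo H ε X, ⟨isHermitian_expo hH hX, ?_⟩, ?_⟩
    · have h2 : (tensor γ * expo H ε X).trace.re =
          ε⁻¹ * ((tensor γ * X).trace.re - (tensor γ * H).trace.re) := by
        rw [expo, Matrix.mul_smul, trace_smul, Complex.real_smul, Complex.re_ofReal_mul, mul_sub,
          trace_sub, Complex.sub_re]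
      rw [h2]
      rw [dualFun] at hr
      have h3 : (NormedSpace.exp (expo H ε X)).trace.re =
        ε⁻¹ * (ε * (NormedSpace.exp (expo H ε X)).trace.re) := by field_simp
      rw [h3, ← mul_sub]
      exact mul_le_mul_of_nonneg_left (by linarith) (inv_pos.2 hε).le
    · simp only [expo, smul_smul, mul_inv_cancel₀ hε.ne', one_smul, sub_add_cancel]

theorem exists_isTransform (hH : H.IsHermitian) (hε : 0 < ε) (hG : (tensor γ).PosDef)
    (hγ : ∀ i, (γ i).trace = 1) (j : Fin N) (U : Potentials d) :
    ∃ V, IsTransform H ε γ j U V := by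
  set f : Herm (d j) →ₗ[ℝ] Op d :=
    ((embedLin j).restrictScalars ℝ).comp
      (selfAdjoint.submodule ℝ (Matrix (Fin (d j)) (Fin (d j)) ℂ)).subtype with hf
  have hinj : Function.Injective f := fun V W h =>
    Subtype.ext (embed_injective hγ j h)
  have hcl : IsClosedEmbedding fun W : Herm (d j) => oplus (Function.update U j W) := by
    have h1 := (Homeomorph.addLeft (oplus (Function.update U j 0))).isClosedEmbedding.comp
      (LinearMap.isClosedEmbedding_of_injective (LinearMap.ker_eq_bot.2 hinj))
    convert h1 using 1
    funext W
    rw [oplus_update U j 0 W, sub_zero]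
    rfl
  set S : Set (Herm (d j)) := (fun W : Herm (d j) => oplus (Function.update U j W)) ⁻¹'
    {X | X.IsHermitian ∧ dual H ε γ U ≤ dualFun H ε γ X} with hS
  have hSc : IsCompact S := hcl.isCompact_preimage (isCompact_dualFun_superlevel hH hε hG hγ _)
  have hU : U j ∈ S := by
    refine ⟨isHermitian_oplus _, ?_⟩
    change _ ≤ dualFun H ε γ (oplus (Function.update U j (U j)))
    rw [Function.update_eq_self, dual_eq_dualFun hγ]
  have hcont : Continuous fun W : Herm (d j) => dual H ε γ (Function.update U j W) := by
    simp only [dual_eq_dualFun hγ]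
    exact continuous_dualFun.comp hcl.continuous
  obtain ⟨V, hV, hmax⟩ := hSc.exists_isMaxOn ⟨_, hU⟩ hcont.continuousOn
  refine ⟨V, fun W _ => ?_⟩
  by_cases hW : W ∈ S
  · exact hmax hW
  · have h1 : dual H ε γ (Function.update U j W) < dual H ε γ U := by
      by_contra hlt
      exact hW ⟨isHermitian_oplus _, by rw [← dual_eq_dualFun hγ]; exact not_lt.1 hlt⟩
    have h2 : dual H ε γ (Function.update U j (U j)) ≤ dual H ε γ (Function.update U j V) :=
      hmax hU
    rw [Function.update_eq_self] at h2
    exact h1.le.trans h2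

theorem IsTransform.stationary (hH : H.IsHermitian) (hε : 0 < ε) (hγ : ∀ i, (γ i).trace = 1)
    {j : Fin N} {U : Potentials d} {V : Herm (d j)} (hV : IsTransform H ε γ j U V) :
    Stationary H ε γ j (oplus (Function.update U j V)) := by
  set X := oplus (Function.update U j V) with hX
  have key (W : Herm (d j)) :
      ((tensor γ - NormedSpace.exp (expo H ε X)) * embed j W.1).trace.re ≤ 0 := by
    set φ : ℝ → ℝ := fun t =>
      ((tensor γ - NormedSpace.exp (expo H ε (X + t • embed j W.1))) * embed j W.1).trace.re with hφ
    have hc : Continuous φ := by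
      have h := continuous_exp_expo (H := H) (ε := ε)
      have h2 : Continuous fun t : ℝ => NormedSpace.exp (expo H ε (X + t • embed j W.1)) :=
        h.comp (by fun_prop)
      fun_prop
    have hneg (t : ℝ) (ht : 0 < t) : φ t ≤ 0 := by
      have h1 : oplus (Function.update U j (V + t • W)) = X + t • embed j W.1 := by
        rw [oplus_update U j V, add_sub_cancel_left]
        congr 1
        exact ((embedLin j).restrictScalars ℝ).map_smul t W.1
      have h2 : dual H ε γ (Function.update U j (V + t • W)) ≤ dual H ε γ (Function.update U j V) :=
        hV (Set.mem_univ _)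
      rw [dual_eq_dualFun hγ, dual_eq_dualFun hγ, h1, ← hX] at h2
      have h3 := dualFun_eq (H := H) (γ := γ) hε (X + t • embed j W.1) X
      have h4 := breg_nonneg
        (isHermitian_expo (ε := ε) hH (h1 ▸ isHermitian_oplus _ : (X + t • embed j W.1).IsHermitian))
        (isHermitian_expo (ε := ε) hH (isHermitian_oplus _ : X.IsHermitian))
      have h5 : X - (X + t • embed j W.1) = -(t • embed j W.1) := by abel
      rw [h5, mul_neg, trace_neg, Complex.neg_re, Matrix.mul_smul, trace_smul, Complex.real_smul,
        Complex.re_ofReal_mul] at h3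
      have h6 : t * φ t ≤ 0 := by
        have := mul_nonneg hε.le h4
        simp only [hφ]
        linarith
      exact nonpos_of_mul_nonpos_right h6 ht
    have hlim : Tendsto φ (𝓝[>] 0) (𝓝 (φ 0)) := hc.continuousWithinAt
    have h0 : φ 0 ≤ 0 := le_of_tendsto hlim (eventually_mem_nhdsWithin.mono fun t ht => hneg t ht)
    simpa [hφ] using h0
  intro W
  refine le_antisymm (key W) ?_
  have h1 := key (-W)
  have h2 : embed (d := d) j (-W).1 = -embed j W.1 := (embedLin j).map_neg W.1
  rw [h2, mul_neg, trace_neg, Complex.neg_re] at h1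
  linarith

theorem IsTransform.dual_eq (hH : H.IsHermitian) (hε : 0 < ε) (hγ : ∀ i, (γ i).trace = 1)
    {j : Fin N} {U : Potentials d} {V : Herm (d j)} (hV : IsTransform H ε γ j U V)
    (W : Herm (d j)) :
    dual H ε γ (Function.update U j W) = dual H ε γ (Function.update U j V) -
      ε * breg (expo H ε (oplus (Function.update U j V)))
        (expo H ε (oplus (Function.update U j W))) := by
  have hs := hV.stationary hH hε hγ (W - V)
  rw [dual_eq_dualFun hγ, dual_eq_dualFun hγ,
    dualFun_eq hε (oplus (Function.update U j V)) (oplus (Function.update U j W)),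
    oplus_update U j V W, add_sub_cancel_left, hs, add_zero]

theorem expo_injective (hε : 0 < ε) : Function.Injective (expo H ε) := fun X Y h => by
  have := smul_right_injective (Op d) (inv_pos.2 hε).ne' h
  exact sub_left_injective this

theorem existsUnique_isTransform (hH : H.IsHermitian) (hε : 0 < ε) (hG : (tensor γ).PosDef)
    (hγ : ∀ i, (γ i).trace = 1) (j : Fin N) (U : Potentials d) :
    ∃! V, IsTransform H ε γ j U V := by
  obtain ⟨V, hV⟩ := exists_isTransform hH hε hG hγ j U
  refine ⟨V, hV, fun W hW => ?_⟩
  have h1 := hV.dual_eq hH hε hγ W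
  have h2 : dual H ε γ (Function.update U j V) ≤ dual H ε γ (Function.update U j W) :=
    hW (Set.mem_univ _)
  have hA := isHermitian_expo (ε := ε) hH (isHermitian_oplus (Function.update U j V))
  have hB := isHermitian_expo (ε := ε) hH (isHermitian_oplus (Function.update U j W))
  have h3 := breg_nonneg hA hB
  have h4 := expo_injective hε (eq_of_breg_eq_zero hA hB (by nlinarith))
  rw [oplus_update U j V W, left_eq_add] at h4
  have h5 : (W - V).1 = 0 := embed_injective hγ j (h4.trans ((embedLin j).map_zero).symm)
  exact sub_eq_zero.1 (Subtype.ext h5)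

theorem isTransform_transform (hH : H.IsHermitian) (hε : 0 < ε) (hG : (tensor γ).PosDef)
    (hγ : ∀ i, (γ i).trace = 1) (j : Fin N) (U : Potentials d) :
    IsTransform H ε γ j U (transform H ε γ j U) :=
  Classical.epsilon_spec (exists_isTransform hH hε hG hγ j U)

theorem stationary_step (hH : H.IsHermitian) (hε : 0 < ε) (hG : (tensor γ).PosDef)
    (hγ : ∀ i, (γ i).trace = 1) (j : Fin N) (U : Potentials d) :
    Stationary H ε γ j (oplus (step H ε γ j U)) :=
  (isTransform_transform hH hε hG hγ j U).stationary hH hε hγ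

theorem dual_eq_dual_step_sub (hH : H.IsHermitian) (hε : 0 < ε) (hG : (tensor γ).PosDef)
    (hγ : ∀ i, (γ i).trace = 1) (j : Fin N) (U : Potentials d) :
    dual H ε γ U = dual H ε γ (step H ε γ j U) -
      ε * breg (expo H ε (oplus (step H ε γ j U))) (expo H ε (oplus U)) := by
  have h := (isTransform_transform hH hε hG hγ j U).dual_eq hH hε hγ (U j)
  rwa [Function.update_eq_self] at h

theorem dual_le_dual_foldl (hH : H.IsHermitian) (hε : 0 < ε) (hG : (tensor γ).PosDef)
    (hγ : ∀ i, (γ i).trace = 1) (l : List (Fin N)) (U : Potentials d) :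
    dual H ε γ U ≤ dual H ε γ (l.foldl (fun W j => step H ε γ j W) U) := by
  induction l generalizing U with
  | nil => exact le_rfl
  | cons j l ih =>
    refine le_trans ?_ (ih (step H ε γ j U))
    have h1 := dual_eq_dual_step_sub hH hε hG hγ j U
    have h2 := breg_nonneg (isHermitian_expo (ε := ε) hH (isHermitian_oplus (step H ε γ j U)))
      (isHermitian_expo (ε := ε) hH (isHermitian_oplus U))
    nlinarith [mul_nonneg hε.le h2]

theorem exists_tendsto_ultrafilter {α β : Type*} [TopologicalSpace β] {K : Set β}
    (hK : IsCompact K) (𝒰 : Ultrafilter α) (f : α → β) (hf : ∀ a, f a ∈ K) :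
    ∃ x ∈ K, Tendsto f 𝒰 (𝓝 x) :=
  hK.ultrafilter_le_nhds (𝒰.map f) (le_principal_iff.2 (univ_mem' (f := (𝒰 : Filter α)) hf))

/-- If the increments of the dual functional over the steps in `l` tend to zero, then the limit is
stationary in every block of `l`. -/
theorem stationary_of_tendsto (hH : H.IsHermitian) (hε : 0 < ε) (hG : (tensor γ).PosDef)
    (hγ : ∀ i, (γ i).trace = 1) (𝒰 : Ultrafilter ℕ) (r : ℝ) (l : List (Fin N))
    (V : ℕ → Potentials d) (X : Op d) (hr : ∀ n, r ≤ dual H ε γ (V n))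
    (hX : Tendsto (fun n => oplus (V n)) 𝒰 (𝓝 X))
    (hD : Tendsto (fun n => dual H ε γ (l.foldl (fun W j => step H ε γ j W) (V n)) -
      dual H ε γ (V n)) 𝒰 (𝓝 0)) :
    ∀ j ∈ l, Stationary H ε γ j X := by
  induction l generalizing V with
  | nil => simp
  | cons j l ih =>
    simp only [List.foldl_cons] at hD
    set V' : ℕ → Potentials d := fun n => step H ε γ j (V n) with hV'
    have hinc (n : ℕ) := dual_eq_dual_step_sub hH hε hG hγ j (V n)
    have hle (n : ℕ) := dual_le_dual_foldl hH hε hG hγ l (V' n)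
    have hHerm (U : Potentials d) := isHermitian_expo (ε := ε) hH (isHermitian_oplus U)
    have hbreg (n : ℕ) : 0 ≤ ε * breg (expo H ε (oplus (V' n))) (expo H ε (oplus (V n))) :=
      mul_nonneg hε.le (breg_nonneg (hHerm _) (hHerm _))
    have hr' (n : ℕ) : r ≤ dual H ε γ (V' n) := by
      have := hr n; have := hinc n; have := hbreg n; simp only [hV'] at *; linarith
    obtain ⟨X', hX'm, hX'⟩ : ∃ X' : Op d, X'.IsHermitian ∧
        Tendsto (fun n => oplus (V' n)) 𝒰 (𝓝 X') := by
      obtain ⟨X', h1, h2⟩ := exists_tendsto_ultrafilter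
        (isCompact_dualFun_superlevel hH hε hG hγ r) 𝒰 (fun n => oplus (V' n))
        fun n => ⟨isHermitian_oplus _, by rw [← dual_eq_dualFun hγ]; exact hr' n⟩
      exact ⟨X', h1.1, h2⟩
    have hXm : X.IsHermitian := by
      have h1 : Continuous fun Y : Op d => Yᴴ := by fun_prop
      exact (isClosed_eq h1 continuous_id).mem_of_tendsto hX
        (Eventually.of_forall fun n => isHermitian_oplus _)
    have hb0 : Tendsto (fun n => ε * breg (expo H ε (oplus (V' n))) (expo H ε (oplus (V n))))
        𝒰 (𝓝 0) := by
      refine squeeze_zero hbreg (fun n => ?_) hD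
      have := hinc n; have := hle n; simp only [hV'] at *; linarith
    have hb1 : Tendsto (fun n => ε * breg (expo H ε (oplus (V' n))) (expo H ε (oplus (V n))))
        𝒰 (𝓝 (ε * breg (expo H ε X') (expo H ε X))) :=
      (((continuous_breg.tendsto (expo H ε X', expo H ε X)).comp
        (((continuous_expo.tendsto X').comp hX').prodMk_nhds
          ((continuous_expo.tendsto X).comp hX))).const_mul ε)
    have hXX : X' = X := by
      have h0 := tendsto_nhds_unique hb1 hb0
      exact expo_injective hε (eq_of_breg_eq_zero (isHermitian_expo hH hX'm)
        (isHermitian_expo hH hXm) ((mul_eq_zero.1 h0).resolve_left hε.ne'))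
    subst hXX
    have hj : Stationary H ε γ j X' := (isClosed_stationary j).mem_of_tendsto hX'
      (Eventually.of_forall fun n => stationary_step hH hε hG hγ j (V n))
    have hD' : Tendsto (fun n => dual H ε γ (l.foldl (fun W j => step H ε γ j W) (V' n)) -
        dual H ε γ (V' n)) 𝒰 (𝓝 0) := by
      refine squeeze_zero (fun n => sub_nonneg.2 (hle n)) (fun n => ?_) hD
      have := hinc n; have := hbreg n; simp only [hV'] at *; linarith
    intro k hk
    rcases List.mem_cons.1 hk with rfl | hk
    · exact hj
    · exact ih V' hr' hX' hD' k hk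

theorem trace_re_eq_zero_of_stationary {X : Op d} (hX : ∀ j, Stationary H ε γ j X)
    (U : Potentials d) :
    ((tensor γ - NormedSpace.exp (expo H ε X)) * oplus U).trace.re = 0 := by
  rw [oplus, Finset.mul_sum, trace_sum, Complex.re_sum]
  exact Finset.sum_eq_zero fun j _ => hX j (U j)

theorem dualFun_eq_of_stationary (hε : 0 < ε) {U : Potentials d}
    (hU : ∀ j, Stationary H ε γ j (oplus U)) (V : Potentials d) :
    dualFun H ε γ (oplus V) = dualFun H ε γ (oplus U) -
      ε * breg (expo H ε (oplus U)) (expo H ε (oplus V)) := by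
  have h1 : oplus V - oplus U = oplus (V - U) := ((oplusLin (d := d)).map_sub V U).symm
  rw [dualFun_eq hε (oplus U) (oplus V), h1, trace_re_eq_zero_of_stationary hU, add_zero]

theorem oplus_eq_of_stationary (hH : H.IsHermitian) (hε : 0 < ε) {U V : Potentials d}
    (hU : ∀ j, Stationary H ε γ j (oplus U)) (hV : ∀ j, Stationary H ε γ j (oplus V)) :
    oplus U = oplus V := by
  have h1 := dualFun_eq_of_stationary hε hU V
  have h2 := dualFun_eq_of_stationary hε hV U
  have hA := isHermitian_expo (ε := ε) hH (isHermitian_oplus U)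
  have hB := isHermitian_expo (ε := ε) hH (isHermitian_oplus V)
  have h3 := mul_nonneg hε.le (breg_nonneg hA hB)
  have h4 := mul_nonneg hε.le (breg_nonneg hB hA)
  have h5 : ε * breg (expo H ε (oplus U)) (expo H ε (oplus V)) = 0 := by linarith
  exact expo_injective hε (eq_of_breg_eq_zero hA hB ((mul_eq_zero.1 h5).resolve_left hε.ne'))

theorem isDualOptimal_of_stationary (hH : H.IsHermitian) (hε : 0 < ε)
    (hγ : ∀ i, (γ i).trace = 1) {U : Potentials d} (hU : ∀ j, Stationary H ε γ j (oplus U)) :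
    IsDualOptimal H ε γ U := by
  intro V _
  have h1 := dualFun_eq_of_stationary hε hU V
  have h3 := mul_nonneg hε.le (breg_nonneg (isHermitian_expo (ε := ε) hH (isHermitian_oplus U))
    (isHermitian_expo (ε := ε) hH (isHermitian_oplus V)))
  change dual H ε γ V ≤ dual H ε γ U
  rw [dual_eq_dualFun hγ, dual_eq_dualFun hγ]
  linarith

theorem Stationary.trace_eq (hH : H.IsHermitian) (hγ : ∀ i, IsDensity (γ i)) {j : Fin N}
    {X : Op d} (hXm : X.IsHermitian) (hX : Stationary H ε γ j X)
    (A : Matrix (Fin (d j)) (Fin (d j)) ℂ) :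
    (γ j * A).trace = (NormedSpace.exp (expo H ε X) * embed j A).trace := by
  set G := tensor γ - NormedSpace.exp (expo H ε X) with hG
  have hGm : Gᴴ = G := by
    have h1 : (tensor γ)ᴴ = tensor γ := by
      rw [conjTranspose_tensor]
      exact congrArg tensor (funext fun i => (hγ i).1.isHermitian)
    rw [hG, conjTranspose_sub, h1, (isHermitian_expo hH hXm).exp]
  have hre (A : Matrix (Fin (d j)) (Fin (d j)) ℂ) : (G * embed j A).trace.re = 0 := by
    have h1 : (G * embed j Aᴴ).trace.re = (G * embed j A).trace.re := by
      rw [← conjTranspose_embed, trace_mul_comm]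
      conv_lhs => rw [← hGm]
      rw [← conjTranspose_mul, trace_conjTranspose, Complex.star_def, Complex.conj_re]
    have h2 := hX ⟨A + Aᴴ, by
      rw [selfAdjoint.mem_iff, star_eq_conjTranspose, conjTranspose_add,
        conjTranspose_conjTranspose, add_comm]⟩
    have h3 : embed (d := d) j (A + Aᴴ) = embed j A + embed j Aᴴ := (embedLin j).map_add _ _
    rw [h3, ← hG, mul_add, trace_add, Complex.add_re, h1] at h2
    linarith
  have him : (G * embed j A).trace.im = 0 := by
    have h1 := hre (Complex.I • A)
    have h2 : embed (d := d) j (Complex.I • A) = Complex.I • embed j A := (embedLin j).map_smul _ _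
    rw [h2, Matrix.mul_smul, trace_smul, smul_eq_mul, Complex.I_mul_re] at h1
    linarith
  have h0 : (G * embed j A).trace = 0 := Complex.ext (hre A) him
  rw [hG, sub_mul, trace_sub, trace_tensor_mul_embed_of_trace_eq_one fun i => (hγ i).2] at h0
  exact sub_eq_zero.1 h0

theorem Stationary.isDensity (hH : H.IsHermitian) (hγ : ∀ i, IsDensity (γ i)) {j : Fin N}
    {X : Op d} (hXm : X.IsHermitian) (hX : Stationary H ε γ j X) :
    IsDensity (NormedSpace.exp (expo H ε X)) := by
  refine ⟨posSemidef_exp (isHermitian_expo hH hXm), ?_⟩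
  have h := hX.trace_eq hH hγ hXm 1
  rw [embed_one, mul_one, mul_one, (hγ j).2] at h
  exact h.symm

/-- Weak duality. -/
theorem dual_le_primal (hH : H.IsHermitian) (hε : 0 < ε) (U : Potentials d) {Γ : Op d}
    (hΓ : Γ ∈ admissible γ) : dual H ε γ U ≤ primal H ε Γ := by
  have h1 := trace_mul_sub_trace_exp_le_entropy hΓ.1.1
    (isHermitian_expo (ε := ε) hH (isHermitian_oplus U))
  have h2 : ∑ i, ((U i).1 * γ i).trace.re = (Γ * oplus U).trace.re := by
    rw [oplus, Finset.mul_sum, trace_sum, Complex.re_sum]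
    exact Finset.sum_congr rfl fun i _ => by rw [trace_mul_comm, hΓ.2 i]
  have h3 : (Γ * expo H ε (oplus U)).trace.re =
      ε⁻¹ * ((Γ * oplus U).trace.re - (H * Γ).trace.re) := by
    rw [expo, Matrix.mul_smul, trace_smul, Complex.real_smul, Complex.re_ofReal_mul, mul_sub,
      trace_sub, Complex.sub_re, trace_mul_comm Γ H]
  rw [h3, hΓ.1.2, Complex.one_re] at h1
  have h4 := mul_le_mul_of_nonneg_left h1 hε.le
  rw [mul_sub, mul_inv_cancel_left₀ hε.ne'] at h4
  rw [dual, primal, entropy, h2]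
  change _ - ε * (NormedSpace.exp (expo H ε (oplus U))).trace.re + ε ≤ _
  linarith

theorem isPrimalOptimal_of_stationary (hN : 1 ≤ N) (hH : H.IsHermitian) (hε : 0 < ε)
    (hγ : ∀ i, IsDensity (γ i)) {U : Potentials d} (hU : ∀ j, Stationary H ε γ j (oplus U)) :
    IsPrimalOptimal H ε γ (gibbs H ε U) := by
  have hUm := isHermitian_oplus U
  have hdens : IsDensity (gibbs H ε U) := (hU ⟨0, hN⟩).isDensity hH hγ hUm
  have hmarg : HasMarginals (gibbs H ε U) γ := fun i A => (hU i).trace_eq hH hγ hUm A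
  refine ⟨⟨hdens, hmarg⟩, fun Γ hΓ => le_trans (le_of_eq ?_) (dual_le_primal hH hε U hΓ)⟩
  have h1 : cfc Real.log (gibbs H ε U) = expo H ε (oplus U) := cfc_log_exp (isHermitian_expo hH hUm)
  have h2 : ∑ i, ((U i).1 * γ i).trace.re = (gibbs H ε U * oplus U).trace.re := by
    rw [oplus, Finset.mul_sum, trace_sum, Complex.re_sum]
    exact Finset.sum_congr rfl fun i _ => by rw [trace_mul_comm, hmarg i]
  rw [primal, entropy, h1, dual, h2, hdens.2, expo, Matrix.mul_smul, trace_smul, Complex.real_smul,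
    Complex.re_ofReal_mul, mul_inv_cancel_left₀ hε.ne', mul_sub, trace_sub, Complex.sub_re,
    trace_mul_comm (gibbs H ε U) H, Complex.one_re]
  ring

theorem exists_stationary_sinkhorn (hN : 1 ≤ N) (hH : H.IsHermitian) (hε : 0 < ε)
    (hG : (tensor γ).PosDef) (hγ : ∀ i, (γ i).trace = 1) (U : Potentials d) :
    ∃ j, Stationary H ε γ j (oplus (sinkhorn H ε γ U)) := by
  rcases List.eq_nil_or_concat' (List.finRange N) with h | ⟨l, j, h⟩
  · rw [List.finRange_eq_nil_iff] at h
    omega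
  · refine ⟨j, ?_⟩
    rw [sinkhorn, h, List.foldl_append]
    exact stationary_step hH hε hG hγ j _

theorem exists_linear_section : ∃ L : Op d →ₗ[ℝ] Potentials d,
    ∀ U : Potentials d, oplus (L (oplus U)) = oplus U := by
  obtain ⟨g, hg⟩ := (oplusLin (d := d)).rangeRestrict.exists_rightInverse_of_surjective
    (LinearMap.range_rangeRestrict _)
  obtain ⟨L, hL⟩ := LinearMap.exists_extend g
  refine ⟨L, fun U => ?_⟩
  have h1 : L (oplus U) = g ((oplusLin (d := d)).rangeRestrict U) := by
    rw [← hL]; rfl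
  rw [h1]
  exact congrArg Subtype.val (LinearMap.congr_fun hg ((oplusLin (d := d)).rangeRestrict U))

theorem iterate_succ (U₀ : Potentials d) (n : ℕ) :
    iterate H ε γ U₀ (n + 1) = sinkhorn H ε γ (iterate H ε γ U₀ n) := by
  rw [iterate, Function.iterate_succ_apply', iterate]

theorem monotone_dual_iterate (hH : H.IsHermitian) (hε : 0 < ε) (hG : (tensor γ).PosDef)
    (hγ : ∀ i, (γ i).trace = 1) (U₀ : Potentials d) :
    Monotone fun n => dual H ε γ (iterate H ε γ U₀ n) :=
  monotone_nat_of_le_succ fun n => by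
    rw [iterate_succ]
    exact dual_le_dual_foldl hH hε hG hγ _ _

theorem dual_le_dual_iterate (hH : H.IsHermitian) (hε : 0 < ε) (hG : (tensor γ).PosDef)
    (hγ : ∀ i, (γ i).trace = 1) (U₀ : Potentials d) (n : ℕ) :
    dual H ε γ U₀ ≤ dual H ε γ (iterate H ε γ U₀ n) := by
  have h := monotone_dual_iterate hH hε hG hγ U₀ (Nat.zero_le n)
  have h0 : iterate H ε γ U₀ 0 = U₀ := by rw [iterate, Function.iterate_zero_apply]
  simpa only [h0] using h

theorem tendsto_dual_sinkhorn_sub (hH : H.IsHermitian) (hε : 0 < ε) (hG : (tensor γ).PosDef)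
    (hγ : ∀ i, (γ i).trace = 1) (U₀ : Potentials d) :
    Tendsto (fun n => dual H ε γ (sinkhorn H ε γ (iterate H ε γ U₀ n)) -
      dual H ε γ (iterate H ε γ U₀ n)) atTop (𝓝 0) := by
  have hbdd : BddAbove (Set.range fun n => dual H ε γ (iterate H ε γ U₀ n)) := by
    refine ((isCompact_dualFun_superlevel hH hε hG hγ (dual H ε γ U₀)).bddAbove_image
      (f := dualFun H ε γ) continuous_dualFun.continuousOn).mono ?_
    rintro _ ⟨n, rfl⟩
    refine ⟨oplus (iterate H ε γ U₀ n), ⟨isHermitian_oplus _, ?_⟩, (dual_eq_dualFun hγ _).symm⟩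
    rw [← dual_eq_dualFun hγ]
    exact dual_le_dual_iterate hH hε hG hγ U₀ n
  have hlim := tendsto_atTop_ciSup (monotone_dual_iterate hH hε hG hγ U₀) hbdd
  have h := (hlim.comp (tendsto_add_atTop_nat 1)).sub hlim
  rw [sub_self] at h
  simpa only [Function.comp_def, iterate_succ] using h

theorem exists_tendsto_oplus_iterate (hH : H.IsHermitian) (hε : 0 < ε)
    (hG : (tensor γ).PosDef) (hγ : ∀ i, (γ i).trace = 1) (L : Op d →ₗ[ℝ] Potentials d)
    (hL : ∀ U : Potentials d, oplus (L (oplus U)) = oplus U) (U₀ : Potentials d) :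
    ∃ X : Op d, oplus (L X) = X ∧ (∀ j, Stationary H ε γ j X) ∧
      Tendsto (fun n => oplus (iterate H ε γ U₀ n)) atTop (𝓝 X) := by
  have hr := dual_le_dual_iterate hH hε hG hγ U₀
  have hK := isCompact_dualFun_superlevel hH hε hG hγ (dual H ε γ U₀)
  have hmem (n : ℕ) : oplus (iterate H ε γ U₀ n) ∈
      {X : Op d | X.IsHermitian ∧ dual H ε γ U₀ ≤ dualFun H ε γ X} :=
    ⟨isHermitian_oplus _, by rw [← dual_eq_dualFun hγ]; exact hr n⟩
  have hinc := tendsto_dual_sinkhorn_sub hH hε hG hγ U₀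
  have hcont : Continuous fun X => oplus (L X) :=
    continuous_oplus.comp L.continuous_of_finiteDimensional
  have hult (𝒰 : Ultrafilter ℕ) (h𝒰 : (𝒰 : Filter ℕ) ≤ atTop) : ∃ X : Op d, oplus (L X) = X ∧
      (∀ j, Stationary H ε γ j X) ∧
      Tendsto (fun n => oplus (iterate H ε γ U₀ n)) 𝒰 (𝓝 X) := by
    obtain ⟨X, -, hX'⟩ := exists_tendsto_ultrafilter hK 𝒰
      (fun n => oplus (iterate H ε γ U₀ n)) hmem
    refine ⟨X, ?_, fun j => ?_, hX'⟩
    · exact (isClosed_eq hcont continuous_id).mem_of_tendsto hX'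
        (Eventually.of_forall fun n => hL _)
    · exact stationary_of_tendsto hH hε hG hγ 𝒰 _ (List.finRange N) _ X hr hX' (hinc.mono_left h𝒰)
        j (List.mem_finRange j)
  obtain ⟨X, hXL, hXs, -⟩ := hult (Ultrafilter.of atTop) (Ultrafilter.of_le atTop)
  refine ⟨X, hXL, hXs, (tendsto_iff_ultrafilter _ _ _).2 fun 𝒰 h𝒰 => ?_⟩
  obtain ⟨Y, hYL, hYs, hY⟩ := hult 𝒰 h𝒰
  have : oplus (L X) = oplus (L Y) :=
    oplus_eq_of_stationary (γ := γ) hH hε (by rwa [hXL]) (by rwa [hYL])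
  rw [hXL, hYL] at this
  rwa [this]

end Optimization

end QuantumSinkhorn

theorem mainTheorem2 {N : ℕ} (hN : 1 ≤ N) (d : Fin N → ℕ)
    (H : QuantumSinkhorn.Op d) (hH : H.IsHermitian) (ε : ℝ) (hε : 0 < ε)
    (γ : (i : Fin N) → Matrix (Fin (d i)) (Fin (d i)) ℂ)
    (hγ : ∀ i, QuantumSinkhorn.IsDensity (γ i))
    (hker : ∀ i, ∀ v : Fin (d i) → ℂ, (γ i).mulVec v = 0 → v = 0) :
    (∀ (j : Fin N) (U : QuantumSinkhorn.Potentials d),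
      ∃! V : QuantumSinkhorn.Herm (d j), QuantumSinkhorn.IsTransform H ε γ j U V) ∧
    ∀ U₀ : QuantumSinkhorn.Potentials d,
      (∀ n : ℕ, 1 ≤ n → QuantumSinkhorn.IsDensity
        (QuantumSinkhorn.gibbs H ε (QuantumSinkhorn.iterate H ε γ U₀ n))) ∧
      ∃ (Uε : QuantumSinkhorn.Potentials d) (α : ℕ → Fin N → ℝ),
        (∀ n, ∑ i, α n i = 0) ∧
        Filter.Tendsto
          (fun n => QuantumSinkhorn.shift (QuantumSinkhorn.iterate H ε γ U₀ n) (α n))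
          Filter.atTop (nhds Uε) ∧
        QuantumSinkhorn.IsDualOptimal H ε γ Uε ∧
        ∃ Γε : QuantumSinkhorn.Op d,
          Filter.Tendsto
            (fun n => QuantumSinkhorn.gibbs H ε (QuantumSinkhorn.iterate H ε γ U₀ n))
            Filter.atTop (nhds Γε) ∧
          QuantumSinkhorn.IsPrimalOptimal H ε γ Γε ∧
          Γε = QuantumSinkhorn.gibbs H ε Uε := by

  have hγ1 (i) : (γ i).trace = 1 := (hγ i).2
  have hG := QuantumSinkhorn.posDef_tensor (fun i => (hγ i).1) hker
  refine ⟨QuantumSinkhorn.existsUnique_isTransform hH hε hG hγ1, fun U₀ => ⟨fun n hn => ?_, ?_⟩⟩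
  · obtain ⟨m, rfl⟩ := Nat.exists_eq_succ_of_ne_zero (Nat.one_le_iff_ne_zero.1 hn)
    rw [QuantumSinkhorn.iterate, Function.iterate_succ_apply']
    obtain ⟨j, hj⟩ := QuantumSinkhorn.exists_stationary_sinkhorn hN hH hε hG hγ1
      ((QuantumSinkhorn.sinkhorn H ε γ)^[m] U₀)
    exact hj.isDensity hH hγ (QuantumSinkhorn.isHermitian_oplus _)
  · obtain ⟨L, hL⟩ := QuantumSinkhorn.exists_linear_section (d := d)
    obtain ⟨X, hXL, hXs, hX⟩ :=
      QuantumSinkhorn.exists_tendsto_oplus_iterate hH hε hG hγ1 L hL U₀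
    choose α hα hshift using fun n =>
      QuantumSinkhorn.exists_shift_of_oplus_eq hγ1 (hL (QuantumSinkhorn.iterate H ε γ U₀ n))
    have hs : ∀ j, QuantumSinkhorn.Stationary H ε γ j (QuantumSinkhorn.oplus (L X)) := by
      rwa [hXL]
    refine ⟨L X, α, hα, ?_, QuantumSinkhorn.isDualOptimal_of_stationary hH hε hγ1 hs,
      QuantumSinkhorn.gibbs H ε (L X), ?_,
      QuantumSinkhorn.isPrimalOptimal_of_stationary hN hH hε hγ hs, rfl⟩
    · simp only [← hshift]
      exact (L.continuous_of_finiteDimensional.tendsto X).comp hX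
    · have h := (QuantumSinkhorn.continuous_exp_expo (H := H) (ε := ε)).tendsto X
      have h2 := h.comp hX
      rw [← hXL] at h2
      exact h2
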